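/- Consider one-dimensional internal diffusion limited aggregation (IDLA) on $\mathbb{Z}$: initially only the origin is occupied. Particles are released one after another at the origin; the current particle moves at each toss of a fair coin (all tosses independent) one step to the right on heads and one step to the left on tails, until it reaches an unoccupied site, where it settles and which becomes occupied; then the next particle is released at the origin. Let $E_n$ be the expected total number of coin tosses needed to reach a state with $n$ occupied sites (the origin included), and let $\Delta E_n$ be the expected number of tosses used by the particle that walks while $n-1$ sites are occupied and that occupies the $n$-th site. Then $E_1=0$ and \[ E_n=\frac{n^3}{12}+\frac{n^2}{12}\qquad\text{for all } n\ge 2 . \] Equivalently, $\Delta E_2=1$ and \[ \Delta E_n=\frac{n^2}{4}-\frac{n}{12}\qquad\text{for all } n\ge 3 . \] In particular all these expectations are finite. -/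

import Mathlib

open scoped ENNReal

namespace IDLA

/-- A configuration of the one-dimensional coin-tossing game: the finite set of occupied sites
and the current position of the walking particle. -/
structure Config where
  /-- the occupied sites -/
  occupied : Finset ℤ
  /-- the position of the particle that is currently walking -/
  position : ℤ

/-- At the beginning only the origin is occupied, and a particle is dropped onto the origin. -/
def Config.initial : Config := ⟨{0}, 0⟩

/-- One coin toss: on heads (`true`) the walking particle moves one step to the right, on tails
(`false`) one step to the left. If it thereby reaches an unoccupied site, it settles there,
occupies that site, and the next particle is dropped onto the origin. -/
def Config.toss (s : Config) (heads : Bool) : Config :=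
  let p : ℤ := s.position + (if heads then 1 else -1)
  if p ∈ s.occupied then ⟨s.occupied, p⟩ else ⟨insert p s.occupied, 0⟩

/-- The configuration of the game after `t` tosses, for the coin sequence `c 0, c 1, …`. -/
def game (c : ℕ → Bool) : ℕ → Config
  | 0 => Config.initial
  | t + 1 => (game c t).toss (c t)

/-- The number of occupied sites after `t` tosses. -/
def numOccupied (c : ℕ → Bool) (t : ℕ) : ℕ := (game c t).occupied.card

/-- The number of tosses needed to reach a state with `n` occupied sites: the first time at which
`n` sites are occupied (it is `⊤` if this never happens). -/
noncomputable def tossesToReach (c : ℕ → Bool) (n : ℕ) : ℕ∞ :=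
  ⨅ (t : ℕ) (_ : numOccupied c t = n), (t : ℕ∞)

/-- The number of tosses used by the particle that walks while `n - 1` sites are occupied and that
occupies the `n`-th site: the number (possibly infinite) of times `t` such that exactly `n - 1`
sites are occupied when the toss `c t` is made. -/
noncomputable def tossesOfParticle (c : ℕ → Bool) (n : ℕ) : ℕ∞ :=
  Set.encard {t : ℕ | numOccupied c t + 1 = n}

end IDLA

open MeasureTheory ProbabilityTheory Filter Topology

/-!
The occupied set is always an interval `[lo, hi]` around the origin, so the game is a Markov chain
on triples `(lo, hi, pos)`. By gambler's ruin, a particle released while `n` sites are occupied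
needs `(1 - lo) (hi + 1) = ((n + 1)² - d²) / 4` tosses in the mean, where `d = lo + hi`, and it
moves `d` to `d + 1` or `d - 1` with probabilities `(1 ∓ d / (n + 1)) / 2`. Hence
`E d'² = d² (n - 1) / (n + 1) + 1`, so that `d² - (n + 1) / 3` is multiplied in the mean by
`(n - 1) / (n + 1)`. From `n = 2` on its mean is `0`, and the particle that walks while `m ≥ 2`
sites are occupied needs `((m + 1)² - (m + 1) / 3) / 4` tosses in the mean.

The proof turns this into a single potential, `Block.potential m`, which is the expected number of
tosses still to be made while `m` sites are occupied. A toss decreases its mean by the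
probability that `m` sites are occupied (`Block.Valid.potential_step`), and telescoping gives the
partial sums of these probabilities (`sum_measureReal_numOccupied`). The potential is bounded and
vanishes as soon as more than `m` sites are occupied. Boundedness makes the probabilities
summable, so the probability of having at most `m` occupied sites tends to `0`, and with it the
remainder (`hasSum_measureReal_numOccupied`). The total number of tosses is the sum over the
particles (`tossesToReach_succ`).
-/

namespace IDLA

/-! ### The occupied interval -/

/-- A configuration whose occupied sites are the integers from `lo` to `hi`, with the walking
particle at `pos`. -/
structure Block where
  /-- the leftmost occupied site -/
  lo : ℤ
  /-- the rightmost occupied site -/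
  hi : ℤ
  /-- the position of the walking particle -/
  pos : ℤ

namespace Block

/-- The blocks that occur in the game: the origin is occupied and the particle stands on an
occupied site. -/
structure Valid (s : Block) : Prop where
  lo_nonpos : s.lo ≤ 0
  hi_nonneg : 0 ≤ s.hi
  lo_le_pos : s.lo ≤ s.pos
  pos_le_hi : s.pos ≤ s.hi

/-- The configuration that a block describes. -/
noncomputable def toConfig (s : Block) : Config := ⟨Finset.Icc s.lo s.hi, s.pos⟩

/-- The number of occupied sites, as an integer; it is a cardinality only if `lo ≤ hi + 1`. -/
def size (s : Block) : ℤ := s.hi - s.lo + 1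

/-- One coin toss, in terms of the end points of the occupied interval. -/
def toss (s : Block) (heads : Bool) : Block :=
  let p : ℤ := s.pos + (if heads then 1 else -1)
  if p < s.lo then ⟨p, s.hi, 0⟩ else if s.hi < p then ⟨s.lo, p, 0⟩ else ⟨s.lo, s.hi, p⟩

/-- The game, started from the block `{0}`. -/
def run (c : ℕ → Bool) : ℕ → Block
  | 0 => ⟨0, 0, 0⟩
  | t + 1 => (run c t).toss (c t)

lemma Valid.toss {s : Block} (hs : s.Valid) (b : Bool) : (s.toss b).Valid := by
  obtain ⟨h1, h2, h3, h4⟩ := hs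
  cases b <;> simp only [Block.toss, reduceIte, Bool.false_eq_true] <;> split_ifs <;> constructor <;>
    dsimp only <;> omega

lemma Valid.run (c : ℕ → Bool) (t : ℕ) : (run c t).Valid := by
  induction t with
  | zero => constructor <;> simp [Block.run]
  | succ t ih => exact ih.toss _

lemma Valid.toConfig_toss {s : Block} (hs : s.Valid) (b : Bool) :
    (s.toss b).toConfig = s.toConfig.toss b := by
  obtain ⟨h1, h2, h3, h4⟩ := hs
  cases b
  all_goals
    simp only [Block.toss, Config.toss, toConfig, Finset.mem_Icc]
    split_ifs <;> first
      | (exfalso; simp_all <;> omega)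
      | rfl
      | (congr 1; ext x; simp_all <;> omega)

lemma toConfig_run (c : ℕ → Bool) (t : ℕ) : (run c t).toConfig = game c t := by
  induction t with
  | zero => rfl
  | succ t ih => rw [run, (Valid.run c t).toConfig_toss, ih, game]

lemma natCast_numOccupied (c : ℕ → Bool) (t : ℕ) : (numOccupied c t : ℤ) = (run c t).size := by
  have h := Valid.run c t
  rw [numOccupied, ← toConfig_run, toConfig, Int.card_Icc, size]
  have h1 := h.lo_nonpos
  have h2 := h.hi_nonneg
  omega

lemma Valid.size_pos {s : Block} (hs : s.Valid) : 1 ≤ s.size := by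
  have h1 := hs.lo_nonpos
  have h2 := hs.hi_nonneg
  rw [size]; omega

lemma run_congr {c d : ℕ → Bool} {t : ℕ} (h : ∀ i < t, c i = d i) : run c t = run d t := by
  induction t with
  | zero => rfl
  | succ t ih => rw [run, run, ih fun i hi => h i (by omega), h t (by omega)]

end Block

/-! ### Hitting times and occupation times -/

lemma numOccupied_zero (c : ℕ → Bool) : numOccupied c 0 = 1 := rfl

lemma numOccupied_le_succ (c : ℕ → Bool) (t : ℕ) : numOccupied c t ≤ numOccupied c (t + 1) := by
  simp only [numOccupied, game]
  unfold Config.toss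
  dsimp only
  generalize (game c t).position + (if c t then 1 else -1) = p
  split_ifs
  · exact le_rfl
  · exact Finset.card_le_card (Finset.subset_insert _ _)

lemma numOccupied_succ_le (c : ℕ → Bool) (t : ℕ) :
    numOccupied c (t + 1) ≤ numOccupied c t + 1 := by
  simp only [numOccupied, game]
  unfold Config.toss
  dsimp only
  generalize (game c t).position + (if c t then 1 else -1) = p
  split_ifs
  · exact Nat.le_succ _
  · exact Finset.card_insert_le _ _

lemma numOccupied_mono (c : ℕ → Bool) : Monotone (numOccupied c) :=
  monotone_nat_of_le_succ (numOccupied_le_succ c)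

lemma one_le_numOccupied (c : ℕ → Bool) (t : ℕ) : 1 ≤ numOccupied c t :=
  numOccupied_mono c (Nat.zero_le t)

lemma numOccupied_eq_one_iff (c : ℕ → Bool) (t : ℕ) : numOccupied c t = 1 ↔ t = 0 := by
  refine ⟨fun h => ?_, fun h => h ▸ numOccupied_zero c⟩
  by_contra ht
  have h1 : numOccupied c 1 = 2 := by
    simp only [numOccupied, game, Config.toss, Config.initial]
    cases c 0 <;> rfl
  have h2 := numOccupied_mono c (Nat.one_le_iff_ne_zero.2 ht)
  omega

/-- The occupation number starts at `1` and never jumps over a value, so the first time at which it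
is `n` counts the times at which it is below `n`, also when `n` is never reached. -/
lemma tossesToReach_eq_encard (c : ℕ → Bool) {n : ℕ} (hn : 1 ≤ n) :
    tossesToReach c n = Set.encard {t : ℕ | numOccupied c t < n} := by
  classical
  by_cases h : ∃ t, numOccupied c t = n
  · have hset : {t : ℕ | numOccupied c t < n} = Set.Iio (Nat.find h) := by
      ext t
      simp only [Set.mem_ofPred_eq, Set.mem_Iio]
      constructor
      · intro ht
        by_contra! hle
        have := numOccupied_mono c hle
        have := Nat.find_spec h
        omega
      · intro ht
        have h1 := numOccupied_mono c ht.le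
        have h2 := Nat.find_spec h
        have h3 := Nat.find_min h ht
        omega
    have hcard : Set.encard (Set.Iio (Nat.find h)) = (Nat.find h : ℕ∞) := by
      rw [← Finset.coe_Iio, Set.encard_coe_eq_coe_finsetCard, Nat.card_Iio]
    rw [hset, hcard]
    apply le_antisymm
    · exact iInf₂_le (Nat.find h) (Nat.find_spec h)
    · exact le_iInf₂ fun t ht => by exact_mod_cast Nat.find_min' h ht
  · push Not at h
    have hset : {t : ℕ | numOccupied c t < n} = Set.univ := by
      refine Set.eq_univ_of_forall fun t => ?_
      simp only [Set.mem_ofPred_eq]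
      induction t with
      | zero =>
        have := h 0
        rw [numOccupied_zero] at this ⊢
        omega
      | succ t ih =>
        have := numOccupied_succ_le c t
        have := h (t + 1)
        omega
    rw [hset, Set.encard_univ, ENat.card_eq_top_of_infinite]
    simp [tossesToReach, h]

lemma tossesToReach_one (c : ℕ → Bool) : tossesToReach c 1 = 0 := by
  rw [tossesToReach_eq_encard c le_rfl, Set.encard_eq_zero]
  ext t
  have := one_le_numOccupied c t
  simp only [Set.mem_ofPred_eq, Set.mem_empty_iff_false, iff_false]
  omega

lemma tossesToReach_succ (c : ℕ → Bool) {n : ℕ} (hn : 1 ≤ n) :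
    tossesToReach c (n + 1) = tossesToReach c n + tossesOfParticle c (n + 1) := by
  rw [tossesToReach_eq_encard c hn, tossesToReach_eq_encard c (by omega), tossesOfParticle,
    ← Set.encard_union_eq]
  · congr 1
    ext t
    simp only [Set.mem_ofPred_eq, Set.mem_union]
    omega
  · rw [Set.disjoint_left]
    intro t
    simp only [Set.mem_ofPred_eq]
    omega

lemma tossesOfParticle_two (c : ℕ → Bool) : tossesOfParticle c 2 = 1 := by
  have : {t : ℕ | numOccupied c t + 1 = 2} = {0} := by
    ext t
    simpa using numOccupied_eq_one_iff c t
  rw [tossesOfParticle, this, Set.encard_singleton]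

lemma tossesOfParticle_eq_tsum (c : ℕ → Bool) (m : ℕ) :
    (tossesOfParticle c (m + 1) : ℝ≥0∞) =
      ∑' t, {t : ℕ | numOccupied c t = m}.indicator (fun _ => 1) t := by
  rw [← tsum_subtype, ENNReal.tsum_set_one, tossesOfParticle]
  simp

/-! ### The potential -/

namespace Block

/-- The expected number of tosses to be made while `m` sites are occupied, for a particle that
stands at the origin while `n` sites are occupied and the end points of the occupied interval add
up to `d`. The formula is meant for `2 ≤ m`: for `m = 1` it divides by `0`. -/
noncomputable def originPotential (m : ℕ) (n d : ℤ) : ℝ :=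
  if n ≤ m then
    ((m + 1 : ℝ) ^ 2 - (m + 1) / 3 - n * (n - 1) / (m * (m - 1)) * (d ^ 2 - (n + 1) / 3)) / 4
  else 0

/-- The expected number of tosses to be made while `m` sites are occupied, from the block `s` on
with the particle moved to `y`. If `m` sites are occupied, the first term is the expected time to
leave the interval; the second term averages `originPotential` over the two exits by the
gambler's ruin probabilities. -/
noncomputable def potentialAt (m : ℕ) (s : Block) (y : ℤ) : ℝ :=
  (if s.size = m then ((y - s.lo + 1) * (s.hi + 1 - y) : ℝ) else 0) +
    ((y - s.lo + 1) * originPotential m (s.size + 1) (s.lo + s.hi + 1) +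
      (s.hi + 1 - y) * originPotential m (s.size + 1) (s.lo + s.hi - 1)) / (s.size + 1)

/-- The expected number of tosses to be made while `m` sites are occupied, from the block `s` on. -/
noncomputable def potential (m : ℕ) (s : Block) : ℝ := potentialAt m s s.pos

/-- The recursion over the number of occupied sites, solved by `originPotential`. -/
lemma Valid.potentialAt_zero {m : ℕ} (hm : 2 ≤ m) {s : Block} (hs : s.Valid) :
    potentialAt m s 0 = originPotential m s.size (s.lo + s.hi) := by
  have hm2 : (2 : ℝ) ≤ m := by exact_mod_cast hm
  have hm0 : (m : ℝ) ≠ 0 := by linarith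
  have hm1 : (m : ℝ) - 1 ≠ 0 := by linarith
  have hn0 : (s.size : ℝ) + 1 ≠ 0 := by
    have : (1 : ℝ) ≤ s.size := by exact_mod_cast hs.size_pos
    linarith
  have hhi : (s.hi : ℝ) = s.size + s.lo - 1 := by rw [size]; push_cast; ring
  unfold potentialAt originPotential
  rcases lt_trichotomy s.size m with h | h | h
  · rw [if_neg h.ne, if_pos (by omega), if_pos (by omega), if_pos h.le]
    push_cast
    rw [hhi]
    field_simp
    ring
  · rw [if_pos h, if_neg (by omega), if_neg (by omega), if_pos h.le]
    have hm' : (m : ℝ) = s.size := by rw [h]; simp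
    rw [hm'] at hm0 hm1 ⊢
    push_cast
    rw [hhi]
    field_simp
    ring
  · rw [if_neg h.ne', if_neg (by omega), if_neg (by omega), if_neg (by omega)]
    simp

lemma Valid.potentialAt_hi {m : ℕ} {s : Block} (hs : s.Valid) :
    potentialAt m s (s.hi + 1) = originPotential m (s.size + 1) (s.lo + s.hi + 1) := by
  have hn0 : (s.size : ℝ) + 1 ≠ 0 := by
    have : (1 : ℝ) ≤ s.size := by exact_mod_cast hs.size_pos
    linarith
  have hhi : (s.hi : ℝ) = s.size + s.lo - 1 := by rw [size]; push_cast; ring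
  unfold potentialAt
  push_cast
  rw [hhi]
  field_simp
  simp
  ring

lemma Valid.potentialAt_lo {m : ℕ} {s : Block} (hs : s.Valid) :
    potentialAt m s (s.lo - 1) = originPotential m (s.size + 1) (s.lo + s.hi - 1) := by
  have hn0 : (s.size : ℝ) + 1 ≠ 0 := by
    have : (1 : ℝ) ≤ s.size := by exact_mod_cast hs.size_pos
    linarith
  have hhi : (s.hi : ℝ) = s.size + s.lo - 1 := by rw [size]; push_cast; ring
  unfold potentialAt
  push_cast
  rw [hhi]
  field_simp
  simp
  ring

/-- Settling a particle does not change the potential: its boundary values are the values at the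
origin for the enlarged block. -/
lemma Valid.potential_toss {m : ℕ} (hm : 2 ≤ m) {s : Block} (hs : s.Valid) (b : Bool) :
    potential m (s.toss b) = potentialAt m s (s.pos + if b then 1 else -1) := by
  have hv := hs.toss b
  have h3 := hs.lo_le_pos
  have h4 := hs.pos_le_hi
  have key : ∀ p : ℤ, s.lo - 1 ≤ p → p ≤ s.hi + 1 → ∀ s' : Block, s'.Valid →
      s' = (if p < s.lo then ⟨p, s.hi, 0⟩ else if s.hi < p then ⟨s.lo, p, 0⟩
        else ⟨s.lo, s.hi, p⟩) → potential m s' = potentialAt m s p := by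
    intro p hp1 hp2 s' hv' hs'
    split_ifs at hs' with hlo hhi
    · obtain rfl : p = s.lo - 1 := by omega
      rw [hs.potentialAt_lo, potential, show s'.pos = 0 by rw [hs'], hv'.potentialAt_zero hm]
      subst hs'
      congr 1 <;> simp only [size] <;> ring
    · obtain rfl : p = s.hi + 1 := by omega
      rw [hs.potentialAt_hi, potential, show s'.pos = 0 by rw [hs'], hv'.potentialAt_zero hm]
      subst hs'
      congr 1 <;> simp only [size] <;> ring
    · subst hs'
      rfl
  exact key _ (by cases b <;> simp <;> omega) (by cases b <;> simp <;> omega) _ hv rfl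

/-- In the mean, a toss decreases the potential by `1` if `m` sites are occupied, and otherwise
leaves it unchanged. -/
lemma Valid.potential_step {m : ℕ} (hm : 2 ≤ m) {s : Block} (hs : s.Valid) :
    (potential m (s.toss true) + potential m (s.toss false)) / 2 =
      potential m s - if s.size = m then 1 else 0 := by
  rw [hs.potential_toss hm, hs.potential_toss hm, potential]
  unfold potentialAt
  split_ifs <;> first | (exfalso; simp_all; done) | (push_cast; ring)

lemma potential_initial {m : ℕ} (hm : 2 ≤ m) :
    potential m ⟨0, 0, 0⟩ = (m + 1 : ℝ) ^ 2 / 4 - (m + 1) / 12 := by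
  have hv : Valid ⟨0, 0, 0⟩ := by constructor <;> simp
  rw [potential, hv.potentialAt_zero hm, originPotential, if_pos (by simp [size]; omega)]
  simp [size]
  ring

lemma potential_eq_zero {m : ℕ} {s : Block} (h : (m : ℤ) < s.size) : potential m s = 0 := by
  unfold potential potentialAt originPotential
  rw [if_neg h.ne', if_neg (by omega), if_neg (by omega)]
  simp

/-- The potential is bounded, since there are only finitely many valid blocks with at most `m`
occupied sites. -/
lemma exists_abs_potential_le (m : ℕ) :
    ∃ C : ℝ, ∀ s : Block, s.Valid → |potential m s| ≤ if s.size ≤ m then C else 0 := by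
  let F : Finset (ℤ × ℤ × ℤ) :=
    Finset.Icc (-m : ℤ) m ×ˢ Finset.Icc (-m : ℤ) m ×ˢ Finset.Icc (-m : ℤ) m
  obtain ⟨C, hC⟩ := (F.finite_toSet.image
    fun x => |potential m ⟨x.1, x.2.1, x.2.2⟩|).bddAbove
  refine ⟨C, fun s hs => ?_⟩
  split_ifs with h
  · refine hC ⟨(s.lo, s.hi, s.pos), ?_, rfl⟩
    obtain ⟨h1, h2, h3, h4⟩ := hs
    rw [size] at h
    simp only [F, Finset.coe_product, Finset.coe_Icc, Set.mem_prod, Set.mem_Icc]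
    omega
  · rw [potential_eq_zero (by omega), abs_zero]

end Block

/-! ### Expectations -/

section Expectation

variable {Ω : Type*} [MeasurableSpace Ω] {μ : Measure Ω} {coin : ℕ → Ω → Bool}

omit [MeasurableSpace Ω] in
/-- The block after `t` tosses factors through the finite tuple of the first `t` coins. -/
lemma Block.exists_run_eq (coin : ℕ → Ω → Bool) (t : ℕ) :
    ∃ F : (Finset.range t → Bool) → Block,
      ∀ ω, Block.run (fun i => coin i ω) t = F (fun i => coin i ω) := by
  refine ⟨fun w => Block.run (fun i => if h : i ∈ Finset.range t then w ⟨i, h⟩ else false) t,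
    fun ω => Block.run_congr fun i hi => ?_⟩
  simp [hi]

lemma measurable_comp_run (hmeas : ∀ i, Measurable (coin i)) {α : Type*} [MeasurableSpace α]
    (f : Block → α) (t : ℕ) : Measurable fun ω => f (Block.run (fun i => coin i ω) t) := by
  obtain ⟨F, hF⟩ := Block.exists_run_eq coin t
  simp only [hF]
  exact (measurable_of_finite fun w => f (F w)).comp
    (measurable_pi_lambda _ fun i => hmeas i)

lemma integrable_comp_run [IsProbabilityMeasure μ] (hmeas : ∀ i, Measurable (coin i))
    (f : Block → ℝ) (t : ℕ) : Integrable (fun ω => f (Block.run (fun i => coin i ω) t)) μ := by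
  obtain ⟨F, hF⟩ := Block.exists_run_eq coin t
  simp only [hF]
  have hX : Measurable fun ω (i : Finset.range t) => coin i ω :=
    measurable_pi_lambda _ fun i => hmeas i
  have := Measure.isProbabilityMeasure_map (μ := μ) hX.aemeasurable
  exact Integrable.comp_measurable (g := fun w => f (F w)) Integrable.of_finite hX

lemma measurableSet_numOccupied (hmeas : ∀ i, Measurable (coin i)) (p : ℕ → Prop) (t : ℕ) :
    MeasurableSet {ω | p (numOccupied (fun i => coin i ω) t)} := by
  have h : ∀ ω, numOccupied (fun i => coin i ω) t =
      (Block.run (fun i => coin i ω) t).toConfig.occupied.card := fun ω => by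
    rw [Block.toConfig_run, numOccupied]
  simp only [h]
  exact measurable_comp_run hmeas (fun s => p s.toConfig.occupied.card) t |>.setOf

lemma indepFun_run_coin (hmeas : ∀ i, Measurable (coin i)) (hindep : iIndepFun coin μ)
    (f : Block → ℝ) (g : Bool → ℝ) (t : ℕ) :
    IndepFun (fun ω => f (Block.run (fun i => coin i ω) t)) (fun ω => g (coin t ω)) μ := by
  obtain ⟨F, hF⟩ := Block.exists_run_eq coin t
  simp only [hF]
  have h := hindep.indepFun_finset (Finset.range t) {t} (by simp) hmeas
  exact h.comp (φ := fun w => f (F w)) (ψ := fun w => g (w ⟨t, by simp⟩))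
    (measurable_of_finite _) (measurable_of_finite _)

lemma integral_indicator_coin [IsProbabilityMeasure μ] (hmeas : ∀ i, Measurable (coin i))
    (hfair : ∀ i, μ {ω | coin i ω = true} = 1 / 2) (t : ℕ) (b : Bool) :
    ∫ ω, (if coin t ω = b then 1 else 0 : ℝ) ∂μ = 1 / 2 := by
  have htrue : MeasurableSet {ω | coin t ω = true} := hmeas t (measurableSet_singleton true)
  have hset : MeasurableSet {ω | coin t ω = b} := hmeas t (measurableSet_singleton b)
  have h1 : μ.real {ω | coin t ω = true} = 1 / 2 := by simp [measureReal_def, hfair]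
  have h2 : μ.real {ω | coin t ω = b} = 1 / 2 := by
    cases b
    · have : {ω | coin t ω = false} = {ω | coin t ω = true}ᶜ := by ext; simp
      rw [this, probReal_compl_eq_one_sub htrue, h1]
      norm_num
    · exact h1
  rw [← h2, ← integral_indicator_one hset]
  simp [Set.indicator_apply]

/-- The Markov property for one toss. -/
lemma integral_run_succ [IsProbabilityMeasure μ] (hmeas : ∀ i, Measurable (coin i))
    (hindep : iIndepFun coin μ) (hfair : ∀ i, μ {ω | coin i ω = true} = 1 / 2)
    (f : Block → ℝ) (t : ℕ) :
    ∫ ω, f (Block.run (fun i => coin i ω) (t + 1)) ∂μ =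
      ∫ ω, (f ((Block.run (fun i => coin i ω) t).toss true) +
        f ((Block.run (fun i => coin i ω) t).toss false)) / 2 ∂μ := by
  have hsplit : ∀ ω, f (Block.run (fun i => coin i ω) (t + 1)) =
      f ((Block.run (fun i => coin i ω) t).toss true) * (if coin t ω = true then 1 else 0) +
      f ((Block.run (fun i => coin i ω) t).toss false) *
        (if coin t ω = false then 1 else 0) := by
    intro ω
    rw [Block.run]
    cases coin t ω <;> simp
  have hind := fun b => indepFun_run_coin hmeas hindep (fun s => f (s.toss b))
    (fun x => if x = b then 1 else 0) t
  have hint := fun b => integrable_comp_run (μ := μ) hmeas (fun s => f (s.toss b)) t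
  have hcoin : ∀ b : Bool, Integrable (fun ω => (if coin t ω = b then 1 else 0 : ℝ)) μ := by
    intro b
    refine Integrable.of_integral_ne_zero ?_
    rw [integral_indicator_coin hmeas hfair]
    norm_num
  have hprod : ∀ b : Bool, ∫ ω, f ((Block.run (fun i => coin i ω) t).toss b) *
      (if coin t ω = b then 1 else 0) ∂μ =
      (∫ ω, f ((Block.run (fun i => coin i ω) t).toss b) ∂μ) * (1 / 2) := by
    intro b
    rw [(hind b).integral_fun_mul_eq_mul_integral (hint b).1 (hcoin b).1,
      integral_indicator_coin hmeas hfair]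
  have hintmul : ∀ b : Bool, Integrable (fun ω => f ((Block.run (fun i => coin i ω) t).toss b) *
      (if coin t ω = b then 1 else 0)) μ :=
    fun b => (hind b).integrable_mul (hint b) (hcoin b)
  simp only [hsplit]
  rw [integral_add (hintmul true) (hintmul false), hprod, hprod, integral_div,
    integral_add (hint true) (hint false)]
  ring

/-- Telescoping the one-step identity for the potential. -/
lemma sum_measureReal_numOccupied [IsProbabilityMeasure μ] (hmeas : ∀ i, Measurable (coin i))
    (hindep : iIndepFun coin μ) (hfair : ∀ i, μ {ω | coin i ω = true} = 1 / 2)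
    {m : ℕ} (hm : 2 ≤ m) (T : ℕ) :
    ∑ t ∈ Finset.range T, μ.real {ω | numOccupied (fun i => coin i ω) t = m} =
      ((m + 1 : ℝ) ^ 2 / 4 - (m + 1) / 12) -
        ∫ ω, (Block.run (fun i => coin i ω) T).potential m ∂μ := by
  induction T with
  | zero => simp [Block.run, Block.potential_initial hm]
  | succ T ih =>
    have hset := measurableSet_numOccupied hmeas (· = m) T
    have hind : ∀ ω, (if (Block.run (fun i => coin i ω) T).size = m then 1 else 0 : ℝ) =
        {ω | numOccupied (fun i => coin i ω) T = m}.indicator 1 ω := by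
      intro ω
      rw [← Block.natCast_numOccupied]
      simp [Set.indicator_apply]
    rw [Finset.sum_range_succ, ih, integral_run_succ hmeas hindep hfair]
    simp only [(Block.Valid.run _ T).potential_step hm, hind]
    have hint : Integrable ({ω | numOccupied (fun i => coin i ω) T = m}.indicator (1 : Ω → ℝ)) μ :=
      (integrable_const (1 : ℝ)).indicator hset
    rw [integral_sub (integrable_comp_run hmeas _ T) hint, integral_indicator_one hset]
    ring

lemma summable_measureReal_numOccupied [IsProbabilityMeasure μ]
    (hmeas : ∀ i, Measurable (coin i)) (hindep : iIndepFun coin μ)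
    (hfair : ∀ i, μ {ω | coin i ω = true} = 1 / 2) {m : ℕ} (hm : 1 ≤ m) :
    Summable fun t => μ.real {ω | numOccupied (fun i => coin i ω) t = m} := by
  rcases hm.eq_or_lt with rfl | hm
  · refine summable_of_ne_finset_zero (s := {0}) fun t ht => ?_
    simp only [Finset.mem_singleton] at ht
    simp [numOccupied_eq_one_iff, ht]
  · obtain ⟨C, hC⟩ := Block.exists_abs_potential_le m
    refine summable_of_sum_range_le (c := ((m + 1 : ℝ) ^ 2 / 4 - (m + 1) / 12) + |C|)
      (fun _ => measureReal_nonneg) fun T => ?_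
    rw [sum_measureReal_numOccupied hmeas hindep hfair hm]
    have h : ‖∫ ω, (Block.run (fun i => coin i ω) T).potential m ∂μ‖ ≤ |C| * μ.real Set.univ := by
      refine norm_integral_le_of_norm_le_const (Eventually.of_forall fun ω => ?_)
      refine (hC _ (Block.Valid.run _ T)).trans ?_
      split_ifs
      · exact le_abs_self C
      · exact abs_nonneg C
    rw [probReal_univ, mul_one, Real.norm_eq_abs] at h
    linarith [(abs_le.1 h).1]

lemma tendsto_measureReal_numOccupied_le [IsProbabilityMeasure μ]
    (hmeas : ∀ i, Measurable (coin i)) (hindep : iIndepFun coin μ)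
    (hfair : ∀ i, μ {ω | coin i ω = true} = 1 / 2) (m : ℕ) :
    Tendsto (fun t => μ.real {ω | numOccupied (fun i => coin i ω) t ≤ m}) atTop (𝓝 0) := by
  induction m with
  | zero =>
    refine tendsto_const_nhds.congr fun t => ?_
    have : {ω | numOccupied (fun i => coin i ω) t ≤ 0} = ∅ := by
      ext ω
      have := one_le_numOccupied (fun i => coin i ω) t
      simp only [Set.mem_ofPred_eq, Set.mem_empty_iff_false, iff_false]
      omega
    rw [this, measureReal_empty]
  | succ m ih =>
    have h := ih.add (summable_measureReal_numOccupied hmeas hindep hfair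
      (Nat.le_add_left 1 m)).tendsto_atTop_zero
    rw [add_zero] at h
    refine squeeze_zero (fun _ => measureReal_nonneg) (fun t => ?_) h
    refine (measureReal_mono ?_).trans (measureReal_union_le _ _)
    intro ω hω
    simp only [Set.mem_ofPred_eq, Set.mem_union] at hω ⊢
    omega

lemma hasSum_measureReal_numOccupied [IsProbabilityMeasure μ] (hmeas : ∀ i, Measurable (coin i))
    (hindep : iIndepFun coin μ) (hfair : ∀ i, μ {ω | coin i ω = true} = 1 / 2)
    {m : ℕ} (hm : 2 ≤ m) :
    HasSum (fun t => μ.real {ω | numOccupied (fun i => coin i ω) t = m})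
      ((m + 1 : ℝ) ^ 2 / 4 - (m + 1) / 12) := by
  rw [hasSum_iff_tendsto_nat_of_nonneg fun _ => measureReal_nonneg]
  simp only [sum_measureReal_numOccupied hmeas hindep hfair hm]
  obtain ⟨C, hC⟩ := Block.exists_abs_potential_le m
  have hbound : ∀ T, ‖∫ ω, (Block.run (fun i => coin i ω) T).potential m ∂μ‖ ≤
      μ.real {ω | numOccupied (fun i => coin i ω) T ≤ m} * C := by
    intro T
    have hset := measurableSet_numOccupied hmeas (· ≤ m) T
    rw [← smul_eq_mul, ← integral_indicator_const C hset]
    refine norm_integral_le_of_norm_le ((integrable_const C).indicator hset)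
      (Eventually.of_forall fun ω => (hC _ (Block.Valid.run _ T)).trans_eq ?_)
    rw [← Block.natCast_numOccupied]
    simp [Set.indicator_apply]
  have h0 := squeeze_zero_norm hbound
    (by simpa using (tendsto_measureReal_numOccupied_le hmeas hindep hfair m).mul_const C)
  simpa using tendsto_const_nhds.sub h0

lemma lintegral_tossesOfParticle [IsProbabilityMeasure μ] (hmeas : ∀ i, Measurable (coin i))
    (hindep : iIndepFun coin μ) (hfair : ∀ i, μ {ω | coin i ω = true} = 1 / 2)
    {n : ℕ} (hn : 3 ≤ n) :
    ∫⁻ ω, (tossesOfParticle (fun i => coin i ω) n : ℝ≥0∞) ∂μ =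
      ENNReal.ofReal ((n : ℝ) ^ 2 / 4 - (n : ℝ) / 12) := by
  obtain ⟨m, rfl⟩ : ∃ m, n = m + 1 := ⟨n - 1, by omega⟩
  have hset := fun t => measurableSet_numOccupied hmeas (· = m) t
  have hind : ∀ (ω : Ω) (t : ℕ),
      {t : ℕ | numOccupied (fun i => coin i ω) t = m}.indicator (fun _ => (1 : ℝ≥0∞)) t =
      {ω | numOccupied (fun i => coin i ω) t = m}.indicator 1 ω := fun ω t => rfl
  have hsum := hasSum_measureReal_numOccupied hmeas hindep hfair (m := m) (by omega)
  simp only [tossesOfParticle_eq_tsum, hind]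
  rw [lintegral_tsum fun t => (measurable_one.indicator (hset t)).aemeasurable]
  simp only [lintegral_indicator_one (hset _)]
  push_cast
  rw [← hsum.tsum_eq, ENNReal.ofReal_tsum_of_nonneg (fun _ => measureReal_nonneg) hsum.summable]
  simp

lemma measurable_tossesOfParticle (hmeas : ∀ i, Measurable (coin i)) (m : ℕ) :
    Measurable fun ω => (tossesOfParticle (fun i => coin i ω) (m + 1) : ℝ≥0∞) := by
  simp only [tossesOfParticle_eq_tsum]
  exact Measurable.tsum fun t =>
    measurable_one.indicator (measurableSet_numOccupied hmeas (· = m) t)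

lemma lintegral_tossesToReach [IsProbabilityMeasure μ] (hmeas : ∀ i, Measurable (coin i))
    (hindep : iIndepFun coin μ) (hfair : ∀ i, μ {ω | coin i ω = true} = 1 / 2)
    {n : ℕ} (hn : 2 ≤ n) :
    ∫⁻ ω, (tossesToReach (fun i => coin i ω) n : ℝ≥0∞) ∂μ =
      ENNReal.ofReal ((n : ℝ) ^ 3 / 12 + (n : ℝ) ^ 2 / 12) := by
  induction n, hn using Nat.le_induction with
  | base =>
    have h : ∀ c, tossesToReach c 2 = 1 := fun c => by
      rw [tossesToReach_succ c le_rfl, tossesToReach_one, tossesOfParticle_two, zero_add]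
    simp only [h]
    norm_num
  | succ n hn ih =>
    simp only [tossesToReach_succ _ (show 1 ≤ n by omega), ENat.toENNReal_add]
    have hn' : (2 : ℝ) ≤ n := by exact_mod_cast hn
    rw [lintegral_add_right _ (measurable_tossesOfParticle hmeas n), ih,
      lintegral_tossesOfParticle hmeas hindep hfair (by omega),
      ← ENNReal.ofReal_add (by positivity) (by push_cast; nlinarith)]
    congr 1
    push_cast
    ring

end Expectation

end IDLA

theorem theorem2 {Ω : Type*} [MeasurableSpace Ω] (μ : MeasureTheory.Measure Ω)
    [MeasureTheory.IsProbabilityMeasure μ]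
    (coin : ℕ → Ω → Bool)
    (hmeas : ∀ i, Measurable (coin i))
    (hindep : ProbabilityTheory.iIndepFun coin μ)
    (hfair : ∀ i, μ {ω | coin i ω = true} = 1 / 2) :
    -- expected total number of tosses to reach `n` occupied sites
    (∫⁻ ω, (IDLA.tossesToReach (fun i => coin i ω) 1 : ℝ≥0∞) ∂μ = 0) ∧
    (∀ n : ℕ, 2 ≤ n →
      ∫⁻ ω, (IDLA.tossesToReach (fun i => coin i ω) n : ℝ≥0∞) ∂μ =
        ENNReal.ofReal ((n : ℝ) ^ 3 / 12 + (n : ℝ) ^ 2 / 12)) ∧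
    -- expected number of tosses used by the `n`-th particle
    (∫⁻ ω, (IDLA.tossesOfParticle (fun i => coin i ω) 2 : ℝ≥0∞) ∂μ = 1) ∧
    (∀ n : ℕ, 3 ≤ n →
      ∫⁻ ω, (IDLA.tossesOfParticle (fun i => coin i ω) n : ℝ≥0∞) ∂μ =
        ENNReal.ofReal ((n : ℝ) ^ 2 / 4 - (n : ℝ) / 12)) := by
  refine ⟨?_, fun n hn => IDLA.lintegral_tossesToReach hmeas hindep hfair hn, ?_,
    fun n hn => IDLA.lintegral_tossesOfParticle hmeas hindep hfair hn⟩
  · simp [IDLA.tossesToReach_one]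
  · simp [IDLA.tossesOfParticle_two]
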